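/- Let $k,l$ be positive integers with $l<k$, let $d=\gcd(l,k)$ and $k=nd$ (so $n>1$). For $a\in\mathrm{GF}(2^k)$ put $P_a(x)=x^{2^l+1}+x+a$, and define polynomials over $\mathrm{GF}(2^k)$ by $C_1(x)=C_2(x)=1$ and $C_{i+2}(x)=C_{i+1}(x)+x^{2^{il}}C_i(x)$ for $i\ge 1$. Let $M_i$ denote the number of $a\in\mathrm{GF}(2^k)^*$ such that $P_a(x)$ has exactly $i$ distinct zeros in $\mathrm{GF}(2^k)$. Then for every $a\in\mathrm{GF}(2^k)^*$, the polynomial $P_a(x)$ has exactly $2^d+1$ distinct zeros in $\mathrm{GF}(2^k)$ if and only if $C_n(a)=0$. Moreover, \[ M_{2^d+1}=\frac{2^{k-d}-1}{2^{2d}-1}\quad\text{if } n \text{ is odd},\qquad M_{2^d+1}=\frac{2^{k-d}-2^d}{2^{2d}-1}\quad\text{if } n \text{ is even}. \] -/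

import Mathlib

open Polynomial

/-- The polynomial `P_a(x) = x^(2^l+1) + x + a`. -/
noncomputable def polyP {K : Type*} [Field K] (l : ℕ) (a : K) : K[X] :=
  X ^ (2 ^ l + 1) + X + Polynomial.C a

/-- The polynomials `C_i(x)`: `C_1 = C_2 = 1` and `C_{i+2} = C_{i+1} + x_i C_i` for `i ≥ 1`,
where `x_i = x^(2^(i*l))`. The value at index `0` is a convention and plays no role. -/
noncomputable def polyC (K : Type*) [Field K] (l : ℕ) : ℕ → K[X]
  | 0 => 0
  | 1 => 1
  | 2 => 1
  | i + 3 => polyC K l (i + 2) + X ^ (2 ^ ((i + 1) * l)) * polyC K l (i + 1)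

/-- The number of (distinct) zeros of `P_a` in `K`. -/
noncomputable def numZerosP {K : Type*} [Field K] (l : ℕ) (a : K) : ℕ :=
  Set.ncard {x : K | (polyP l a).IsRoot x}

/-- `M_i`: the number of nonzero `a` in `K` such that `P_a` has exactly `i` zeros in `K`. -/
noncomputable def countM (K : Type*) [Field K] (l i : ℕ) : ℕ :=
  Set.ncard {a : K | a ≠ 0 ∧ numZerosP l a = i}

/-! ### Cross-ratios of points in a fiber of `x ↦ σ x * x - x`. -/

section Semilinear

variable {K : Type*} [Field K] {σ : K ≃+* K} {a w x y z : K}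

/-! With `σ` the `2^l`-Frobenius and characteristic 2, zeros of `P_a` are solutions of the
semilinear Möbius equation `σ x = (x + a) / x`. Fix two zeros `x`, `y`; then `w = (z - x) / (z - y)`
satisfies `σ w = w * (y / x)` for every further zero `z`. Nonzero solutions `w` differ by factors
fixed by `σ`, so three zeros force `2^d + 1` (`ncard_fiber_of_three`).

Count: ordered triples of distinct zeros, over all `a ≠ 0`, correspond through the cross-ratio to
the `w` with `σ (σ w) ≠ w`. Hence, with `q = 2^d`, `M * (q + 1) * q * (q - 1) = 2^k - 2^gcd(2l, k)`.

Criterion: the norm of a zero `x` is `C_n(a) * x + a * σ (C_{n-1}(a))`. Iterating `σ w = w * (y /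
x)` around the cycle makes the norms of `x` and `y` equal, so `C_n(a) = 0`. Conversely, if `C_n(a) =
0`, then `C_{n+1}(a)` is nonzero and fixed by `σ`, hence a norm of some `b`. Dividing `C_i(a)` by
partial norms of `b` gives a periodic sequence, whose resolvents `z` solve a second-order `σ`-linear
equation; each `b * σ z / z` is a zero, and three are distinct by independence of characters. -/

theorem map_eq_of_fiber (ha : a ≠ 0) (hx : σ x * x - x = a) :
    x ≠ 0 ∧ σ x ≠ 0 ∧ σ x = (x + a) / x ∧ x + a ≠ 0 := by
  have hx0 : x ≠ 0 := by
    rintro rfl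
    exact ha (by simpa using hx.symm)
  have hs : σ x ≠ 0 := by simpa using hx0
  have h : σ x * x = x + a := by linear_combination hx
  exact ⟨hx0, hs, by field_simp; exact h, h ▸ mul_ne_zero hs hx0⟩

theorem map_cross_ratio (ha : a ≠ 0) (hx : σ x * x - x = a) (hy : σ y * y - y = a)
    (hz : σ z * z - z = a) (hyz : z ≠ y) :
    σ ((z - x) / (z - y)) = (z - x) / (z - y) * (y / x) := by
  obtain ⟨hx0, -, hx1, -⟩ := map_eq_of_fiber ha hx
  obtain ⟨hy0, -, hy1, -⟩ := map_eq_of_fiber ha hy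
  obtain ⟨hz0, -, hz1, -⟩ := map_eq_of_fiber ha hz
  have h1 : z - y ≠ 0 := sub_ne_zero.2 hyz
  have h2 : σ z - σ x = a * (x - z) / (x * z) := by rw [hx1, hz1]; field_simp; ring
  have h3 : σ z - σ y = a * (y - z) / (y * z) := by rw [hy1, hz1]; field_simp; ring
  have h4 : y - z ≠ 0 := sub_ne_zero.2 hyz.symm
  rw [map_div₀, map_sub, map_sub, h2, h3]
  field_simp
  ring

theorem map_map_ne_of_map_eq (ha : a ≠ 0) (hx : σ x * x - x = a) (hy : σ y * y - y = a)
    (hxy : x ≠ y) (hw0 : w ≠ 0) (hw : σ w = w * (y / x)) : σ (σ w) ≠ w := by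
  obtain ⟨hx0, hsx, hx1, hxa⟩ := map_eq_of_fiber ha hx
  obtain ⟨hy0, hsy, hy1, hya⟩ := map_eq_of_fiber ha hy
  intro h
  rw [hw, map_mul, map_div₀, hw, hx1, hy1] at h
  field_simp at h
  exact hxy (add_right_cancel h).symm

/-- The point of the fiber with cross-ratio `w` relative to the points `x` and `y`. -/
theorem fiber_of_cross_ratio (ha : a ≠ 0) (hx : σ x * x - x = a) (hy : σ y * y - y = a)
    (hw : σ w = w * (y / x)) (hw1 : w ≠ 1) :
    σ ((x - w * y) / (1 - w)) * ((x - w * y) / (1 - w)) - (x - w * y) / (1 - w) = a := by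
  obtain ⟨hx0, hsx, hx1, hxa⟩ := map_eq_of_fiber ha hx
  obtain ⟨hy0, hsy, hy1, hya⟩ := map_eq_of_fiber ha hy
  have h1 : 1 - w ≠ 0 := sub_ne_zero.2 hw1.symm
  have h2 : 1 - σ w ≠ 0 := by
    rw [← map_one σ, ← map_sub]
    exact (map_ne_zero σ).2 h1
  have h3 : x - w * y ≠ 0 := by
    rw [hw] at h2
    intro h
    apply h2
    field_simp
    simpa using h
  have h4 : 1 - w * (y / x) = (x - w * y) / x := by field_simp
  simp only [map_div₀, map_sub, map_mul, map_one, hx1, hy1, hw, h4]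
  field_simp
  ring

theorem ncard_fiber_of_three (ha : a ≠ 0) (hx : σ x * x - x = a) (hy : σ y * y - y = a)
    (hz : σ z * z - z = a) (hxy : x ≠ y) (hzx : z ≠ x) (hzy : z ≠ y) [Finite K] :
    {v : K | σ v * v - v = a}.ncard = {u : K | σ u = u}.ncard + 1 := by
  set w := (z - x) / (z - y) with hwdef
  have hw0 : w ≠ 0 := div_ne_zero (sub_ne_zero.2 hzx) (sub_ne_zero.2 hzy)
  have hw : σ w = w * (y / x) := map_cross_ratio ha hx hy hz hzy
  obtain ⟨hx0, -⟩ := map_eq_of_fiber ha hx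
  obtain ⟨hy0, -⟩ := map_eq_of_fiber ha hy
  -- Cross-ratio 1 would be the point at infinity, which is never in the fiber because `x ≠ y`.
  have hne1 : ∀ u, σ u = u → u * w ≠ 1 := by
    intro u hu h
    have h' := congrArg σ h
    rw [map_mul, hu, hw, map_one, ← mul_assoc, h, one_mul, div_eq_one_iff_eq hx0] at h'
    exact hxy h'.symm
  have hy' : y ∈ {v : K | σ v * v - v = a} := hy
  -- `y` has infinite cross-ratio and is counted apart; `x` corresponds to `u = 0`.
  rw [← Set.ncard_sdiff_singleton_add_one hy']
  congr 1
  refine Set.ncard_congr (fun v _ => (v - x) / (v - y) / w) ?_ ?_ ?_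
  · rintro v ⟨hv, hvy⟩
    have := map_cross_ratio ha hx hy hv hvy
    rw [Set.mem_ofPred_eq, map_div₀, this, hw]
    field_simp
  · rintro v v' ⟨hv, hvy⟩ ⟨hv', hvy'⟩ h
    have h1 : v - y ≠ 0 := sub_ne_zero.2 hvy
    have h2 : v' - y ≠ 0 := sub_ne_zero.2 hvy'
    field_simp at h
    have : (v - v') * (x - y) = 0 := by linear_combination h
    rcases mul_eq_zero.1 this with h | h
    · exact sub_eq_zero.1 h
    · exact absurd (sub_eq_zero.1 h) hxy
  · intro u hu
    have h1 : 1 - u * w ≠ 0 := sub_ne_zero.2 (hne1 u hu).symm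
    have h2 : x - y ≠ 0 := sub_ne_zero.2 hxy
    have h3 : (x - u * w * y) / (1 - u * w) - y = (x - y) / (1 - u * w) := by
      field_simp; ring
    refine ⟨(x - u * w * y) / (1 - u * w), ⟨?_, ?_⟩, ?_⟩
    · refine fiber_of_cross_ratio ha hx hy ?_ (hne1 u hu)
      rw [map_mul, hu, hw, mul_assoc]
    · intro h
      rw [Set.mem_singleton_iff, ← sub_eq_zero, h3] at h
      exact div_ne_zero h2 h1 h
    · have h4 : (x - u * w * y) / (1 - u * w) - x = u * w * (x - y) / (1 - u * w) := by
        field_simp; ring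
      simp only [h3, h4]
      field_simp

theorem exists_fiber_triple (hw : σ (σ w) ≠ w) :
    ∃ a x y z, a ≠ 0 ∧ σ x * x - x = a ∧ σ y * y - y = a ∧ σ z * z - z = a ∧
      x ≠ y ∧ z ≠ x ∧ z ≠ y ∧ (z - x) / (z - y) = w := by
  -- `b` will be `x`. Its image is forced: `σ w = w * (y / x)` and `σ (σ w) = w * (y + a) / (x +
  -- a)`, so the quotient of differences is `(x + a) / x = σ x`.
  obtain ⟨b, hb⟩ := σ.surjective ((σ w - w) / (σ (σ w) - w))
  have h1 : σ w ≠ w := fun h => hw (by rw [h, h])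
  have h10 : σ w - w ≠ 0 := sub_ne_zero.2 h1
  have h20 : σ (σ w) - w ≠ 0 := sub_ne_zero.2 hw
  have h21 : σ w - σ (σ w) ≠ 0 := by
    rw [← map_sub]
    simpa [sub_eq_zero] using h1.symm
  have hw0 : w ≠ 0 := by rintro rfl; simp at h1
  have hw1 : w - 1 ≠ 0 := by
    intro h; rw [sub_eq_zero] at h; subst h; simp at h1
  have hs0 : σ w ≠ 0 := by simpa using hw0
  have hs1 : σ w - 1 ≠ 0 := by
    rw [← map_one σ, ← map_sub]; exact (map_ne_zero σ).2 hw1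
  have hb0 : b ≠ 0 := by
    rintro rfl
    rw [map_zero] at hb
    exact div_ne_zero h10 h20 hb.symm
  have hzx : b * (σ w - 1) / (w - 1) - b = b * (σ w - w) / (w - 1) := by field_simp; ring
  have hzy : b * (σ w - 1) / (w - 1) - b * σ w / w = b * (σ w - w) / (w * (w - 1)) := by
    field_simp; ring
  refine ⟨b * (σ w - σ (σ w)) / (σ (σ w) - w), b, b * σ w / w, b * (σ w - 1) / (w - 1),
    div_ne_zero (mul_ne_zero hb0 h21) h20, ?_, ?_, ?_, ?_, ?_, ?_, ?_⟩
  · rw [hb]; field_simp; ring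
  · simp only [map_mul, map_div₀, hb]; field_simp; ring
  · simp only [map_mul, map_div₀, map_sub, map_one, hb]; field_simp; ring
  · intro h
    field_simp at h
    exact h1 h.symm
  · rw [← sub_ne_zero, hzx]
    exact div_ne_zero (mul_ne_zero hb0 h10) hw1
  · rw [← sub_ne_zero, hzy]
    exact div_ne_zero (mul_ne_zero hb0 h10) (mul_ne_zero hw0 hw1)
  · rw [hzx, hzy]; field_simp

/-- A triple of distinct points of a common fiber is determined by its cross-ratio. -/
theorem fiber_triple_injective {a' x' y' z' : K} (ha : a ≠ 0) (hx : σ x * x - x = a)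
    (hy : σ y * y - y = a) (hz : σ z * z - z = a) (hxy : x ≠ y) (hzx : z ≠ x) (hzy : z ≠ y)
    (ha' : a' ≠ 0) (hx' : σ x' * x' - x' = a') (hy' : σ y' * y' - y' = a')
    (hz' : σ z' * z' - z' = a') (hxy' : x' ≠ y') (hzx' : z' ≠ x') (hzy' : z' ≠ y')
    (h : (z - x) / (z - y) = (z' - x') / (z' - y')) : x = x' ∧ y = y' ∧ z = z' := by
  have key : ∀ {a x y z : K}, a ≠ 0 → σ x * x - x = a → σ y * y - y = a → σ z * z - z = a →
      x ≠ y → z ≠ x → z ≠ y → ∀ w, (z - x) / (z - y) = w →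
      σ x = (σ w - w) / (σ (σ w) - w) ∧ y = x * σ w / w ∧ z = (x - w * y) / (1 - w) := by
    intro a x y z ha hx hy hz hxy hzx hzy w hwdef
    have hw0 : w ≠ 0 := hwdef ▸ div_ne_zero (sub_ne_zero.2 hzx) (sub_ne_zero.2 hzy)
    have hw : σ w = w * (y / x) := hwdef ▸ map_cross_ratio ha hx hy hz hzy
    obtain ⟨hx0, hsx, hx1, hxa⟩ := map_eq_of_fiber ha hx
    obtain ⟨hy0, hsy, hy1, hya⟩ := map_eq_of_fiber ha hy
    have h1 : z - y ≠ 0 := sub_ne_zero.2 hzy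
    have h2 : x - y ≠ 0 := sub_ne_zero.2 hxy
    refine ⟨?_, ?_, ?_⟩
    · rw [eq_div_iff (sub_ne_zero.2 (map_map_ne_of_map_eq ha hx hy hxy hw0 hw)), hw, map_mul,
        map_div₀, hw, hx1, hy1]
      field_simp
      ring
    · rw [hw]; field_simp
    · have h3 : 1 - w = (x - y) / (z - y) := by rw [← hwdef]; field_simp; ring
      rw [h3, ← hwdef]
      field_simp
      ring
  obtain ⟨h1, h2, h3⟩ := key ha hx hy hz hxy hzx hzy _ rfl
  obtain ⟨h1', h2', h3'⟩ := key ha' hx' hy' hz' hxy' hzx' hzy' _ h.symm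
  have hxx : x = x' := σ.injective (h1.trans h1'.symm)
  have hyy : y = y' := by rw [h2, h2', hxx]
  exact ⟨hxx, hyy, by rw [h3, h3', hxx, hyy]⟩

end Semilinear

/-! ### Double counting of triples by cross-ratio. -/

section Counting

variable {K : Type*} [Field K] [Finite K] (σ : K ≃+* K)

theorem ncard_full_fibers_mul_descFactorial (N : ℕ)
    (hfib : N = {u : K | σ u = u}.ncard + 1) :
    {a : K | a ≠ 0 ∧ {v : K | σ v * v - v = a}.ncard = N}.ncard * N.descFactorial 3 =
      {w : K | σ (σ w) ≠ w}.ncard := by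
  classical
  have := Fintype.ofFinite K
  let S := {a : K | a ≠ 0 ∧ {v : K | σ v * v - v = a}.ncard = N}
  let f : (Σ a : S, (Fin 3 ↪ {v : K | σ v * v - v = a.1})) → {w : K | σ (σ w) ≠ w} := fun p =>
    ⟨((p.2 2).1 - (p.2 0).1) / ((p.2 2).1 - (p.2 1).1), by
      obtain ⟨⟨a, ha, -⟩, g⟩ := p
      have hg : ∀ i j : Fin 3, i ≠ j → (g i).1 ≠ (g j).1 := fun i j hij h =>
        hij (g.injective (Subtype.ext h))
      exact map_map_ne_of_map_eq ha (g 0).2 (g 1).2 (hg 0 1 (by decide))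
        (div_ne_zero (sub_ne_zero.2 (hg 2 0 (by decide))) (sub_ne_zero.2 (hg 2 1 (by decide))))
        (map_cross_ratio ha (g 0).2 (g 1).2 (g 2).2 (hg 2 1 (by decide)))⟩
  have hf : Function.Bijective f := by
    constructor
    · rintro ⟨⟨a, ha, haN⟩, g⟩ ⟨⟨a', ha', haN'⟩, g'⟩ h
      have hg : ∀ i j : Fin 3, i ≠ j → (g i).1 ≠ (g j).1 := fun i j hij h =>
        hij (g.injective (Subtype.ext h))
      have hg' : ∀ i j : Fin 3, i ≠ j → (g' i).1 ≠ (g' j).1 := fun i j hij h =>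
        hij (g'.injective (Subtype.ext h))
      obtain ⟨h0, h1, h2⟩ := fiber_triple_injective ha (g 0).2 (g 1).2 (g 2).2
        (hg 0 1 (by decide)) (hg 2 0 (by decide)) (hg 2 1 (by decide)) ha' (g' 0).2 (g' 1).2
        (g' 2).2 (hg' 0 1 (by decide)) (hg' 2 0 (by decide)) (hg' 2 1 (by decide))
        (congrArg Subtype.val h)
      obtain rfl : a = a' := by
        have e : σ (g 0).1 * (g 0).1 - (g 0).1 = a := (g 0).2
        have e' : σ (g' 0).1 * (g' 0).1 - (g' 0).1 = a' := (g' 0).2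
        rw [← e, ← e', h0]
      congr 1
      ext i
      fin_cases i
      · exact h0
      · exact h1
      · exact h2
    · rintro ⟨w, hw⟩
      obtain ⟨a, x, y, z, ha, hx, hy, hz, hxy, hzx, hzy, hwe⟩ := exists_fiber_triple hw
      have haN : {v : K | σ v * v - v = a}.ncard = N := by
        rw [hfib, ncard_fiber_of_three ha hx hy hz hxy hzx hzy]
      refine ⟨⟨⟨a, ha, haN⟩, ⟨![⟨x, hx⟩, ⟨y, hy⟩, ⟨z, hz⟩], ?_⟩⟩, Subtype.ext hwe⟩
      intro i j hij
      fin_cases i <;> fin_cases j <;> simp_all [Subtype.ext_iff]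
  have hc := Nat.card_congr (Equiv.ofBijective f hf)
  rw [Nat.card_sigma] at hc
  have he : ∀ a : S, Nat.card (Fin 3 ↪ {v : K | σ v * v - v = a.1}) = N.descFactorial 3 := by
    intro a
    rw [Nat.card_eq_fintype_card, Fintype.card_embedding_eq, Fintype.card_fin,
      ← Nat.card_eq_fintype_card, Nat.card_coe_set_eq, a.2.2]
  rw [Finset.sum_congr rfl fun a _ => he a, Finset.sum_const, Finset.card_univ, smul_eq_mul,
    ← Nat.card_eq_fintype_card, Nat.card_coe_set_eq, Nat.card_coe_set_eq] at hc
  exact hc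

end Counting

/-! ### The values `C_i(a)`, norms of zeros, and construction of zeros. -/

section Continuants

variable {K : Type*} [Field K]

/-- The values of the polynomials `C_i` at `a`, for a general automorphism `σ`. -/
def continuant (σ : RingAut K) (a : K) : ℕ → K
  | 0 => 0
  | 1 => 1
  | i + 2 => continuant σ a (i + 1) + (σ ^ i) a * continuant σ a i

variable {σ : RingAut K} {a x y w : K}

theorem continuant_add_two (σ : RingAut K) (a : K) (i : ℕ) : continuant σ a (i + 2) =
    continuant σ a (i + 1) + (σ ^ i) a * continuant σ a i := rfl

theorem RingAut.pow_succ_apply' (σ : RingAut K) (i : ℕ) (x : K) :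
    (σ ^ (i + 1)) x = σ ((σ ^ i) x) := by rw [pow_succ', RingAut.mul_apply]

theorem RingAut.pow_succ_apply (σ : RingAut K) (i : ℕ) (x : K) :
    (σ ^ (i + 1)) x = (σ ^ i) (σ x) := by rw [pow_succ, RingAut.mul_apply]

/-- Each use of `σ x * x = x + a` keeps the product affine in `x`; for `i + 1 = n` it is the norm of
`x`. -/
theorem prod_pow_apply_eq_continuant (hx : σ x * x - x = a) (i : ℕ) :
    ∏ j ∈ Finset.range (i + 1), (σ ^ j) x =
      continuant σ a (i + 1) * x + a * σ (continuant σ a i) := by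
  induction i using Nat.twoStepInduction with
  | zero => simp [continuant]
  | one =>
    rw [Finset.prod_range_succ, Finset.prod_range_one]
    simp only [continuant, pow_zero, pow_one, RingAut.one_apply, map_one]
    linear_combination hx
  | more i ih1 ih2 =>
    have h := congrArg (σ ^ (i + 1)) hx
    rw [map_sub, map_mul, ← RingAut.pow_succ_apply] at h
    rw [Finset.prod_range_succ, Finset.prod_range_succ, ih1]
    rw [Finset.prod_range_succ, ih1] at ih2
    rw [continuant_add_two σ a (i + 1), continuant_add_two σ a i, map_add, map_mul,
      ← RingAut.pow_succ_apply']
    rw [continuant_add_two σ a i] at ih2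
    linear_combination (continuant σ a (i + 1) * x + a * σ (continuant σ a i)) * h + ih2

theorem continuant_eq_zero_of_map_eq {n : ℕ} (hσ : σ ^ n = 1) (hn : n ≠ 0) (ha : a ≠ 0)
    (hx : σ x * x - x = a) (hy : σ y * y - y = a) (hxy : x ≠ y) (hw0 : w ≠ 0)
    (hw : σ w = w * (y / x)) : continuant σ a n = 0 := by
  obtain ⟨m, rfl⟩ := Nat.exists_eq_succ_of_ne_zero hn
  obtain ⟨hx0, -⟩ := map_eq_of_fiber ha hx
  have hX := prod_pow_apply_eq_continuant hx m
  have hY := prod_pow_apply_eq_continuant hy m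
  have key : ∀ i, (σ ^ i) w * ∏ j ∈ Finset.range i, (σ ^ j) x =
      w * ∏ j ∈ Finset.range i, (σ ^ j) y := by
    intro i
    induction i with
    | zero => simp
    | succ i ih =>
      have h0 : (σ ^ i) x ≠ 0 := (_root_.map_ne_zero _).2 hx0
      rw [Finset.prod_range_succ, Finset.prod_range_succ, RingAut.pow_succ_apply, hw, map_mul,
        map_div₀, ← mul_assoc w, ← ih]
      field_simp
  have h := key (m + 1)
  rw [hσ, RingAut.one_apply, hX, hY] at h
  have h' := mul_left_cancel₀ hw0 h
  have : continuant σ a (m + 1) * (x - y) = 0 := by linear_combination h'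
  exact (mul_eq_zero.1 this).resolve_right (sub_ne_zero.2 hxy)

/-- The continuant expanded from its other end. Comparing both expansions at a zero `C_n(a)` shows
that `σ` fixes `C_{n+1}(a)`. -/
theorem continuant_add_two_eq (i : ℕ) : continuant σ a (i + 2) =
    σ (continuant σ a (i + 1)) + σ a * σ (σ (continuant σ a i)) := by
  induction i using Nat.twoStepInduction with
  | zero => simp [continuant]
  | one => simp [continuant]
  | more i ih1 ih2 =>
    have h1 := congrArg σ (continuant_add_two σ a (i + 1))
    have h2 := congrArg (fun x => σ (σ x)) (continuant_add_two σ a i)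
    simp only [map_add, map_mul, ← RingAut.pow_succ_apply'] at h1 h2
    rw [continuant_add_two σ a (i + 2)]
    linear_combination ih2 + (σ ^ (i + 2)) a * ih1 - h1 - σ a * h2

variable {n : ℕ}

theorem map_continuant_succ (h0 : continuant σ a n = 0) :
    σ (continuant σ a (n + 1)) = continuant σ a (n + 1) := by
  have h := continuant_add_two_eq (σ := σ) (a := a) n
  rw [continuant, h0] at h
  simpa using h.symm

theorem continuant_succ_ne_zero (ha : a ≠ 0) (h0 : continuant σ a n = 0) :
    continuant σ a (n + 1) ≠ 0 := by
  induction n with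
  | zero => simp [continuant]
  | succ n ih =>
    intro h
    rw [continuant, h0, zero_add] at h
    exact ih ((mul_eq_zero.1 h).resolve_left ((_root_.map_ne_zero _).2 ha)) h0

theorem continuant_add (hσ : σ ^ n = 1) (h0 : continuant σ a n = 0) (i : ℕ) :
    continuant σ a (n + i) = continuant σ a (n + 1) * continuant σ a i := by
  induction i using Nat.twoStepInduction with
  | zero => simp [continuant, h0]
  | one => simp [continuant]
  | more i ih1 ih2 =>
    rw [continuant, ← add_assoc, continuant, add_assoc n i 1, ih1, ih2, pow_add, hσ, one_mul]
    ring

/-- Lagrange resolvents built from a periodic sequence `s`. -/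
def cyclicResolvent (σ : RingAut K) (n : ℕ) (s : ℕ → K) (t : K) : K :=
  ∑ i ∈ Finset.range n, (σ ^ i)⁻¹ (t * s i)

theorem RingAut.apply_inv_pow_succ (σ : RingAut K) (i : ℕ) (x : K) :
    σ ((σ ^ (i + 1))⁻¹ x) = (σ ^ i)⁻¹ x := by
  rw [← RingAut.mul_apply]
  congr 1
  group

/-- Periodicity lets the sum be reindexed cyclically, so `σ` acts as the shift on `s`. -/
theorem map_cyclicResolvent (hσ : σ ^ n = 1) {s : ℕ → K} (hs : s n = s 0) (t : K) :
    σ (cyclicResolvent σ n s t) = cyclicResolvent σ n (fun i => s (i + 1)) t := by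
  have h : cyclicResolvent σ n s t = ∑ i ∈ Finset.range n, (σ ^ (i + 1))⁻¹ (t * s (i + 1)) := by
    have h1 := Finset.sum_range_succ (fun i => (σ ^ i)⁻¹ (t * s i)) n
    rw [Finset.sum_range_succ'] at h1
    simp only [hσ, hs, pow_zero] at h1
    exact (add_right_cancel h1).symm
  rw [h, map_sum]
  simp only [RingAut.apply_inv_pow_succ]
  rfl

theorem mul_cyclicResolvent (b : K) (s : ℕ → K) (t : K) :
    b * cyclicResolvent σ n s t = cyclicResolvent σ n (fun i => (σ ^ i) b * s i) t := by
  simp only [cyclicResolvent, Finset.mul_sum]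
  refine Finset.sum_congr rfl fun i _ => ?_
  have : (σ ^ i)⁻¹ ((σ ^ i) b) = b := by rw [← RingAut.mul_apply]; simp
  rw [mul_left_comm, map_mul _ ((σ ^ i) b), this]

theorem eq_zero_of_sum_inv_pow_eq_zero (hσ : orderOf σ = n) {g : ℕ → K}
    (h : ∀ t, ∑ i ∈ Finset.range n, (σ ^ i)⁻¹ t * g i = 0) {i : ℕ} (hi : i < n) : g i = 0 := by
  have hli := linearIndependent_monoidHom K K
  let χ : Fin n → (K →* K) := fun i => (((σ ^ (i : ℕ))⁻¹ : RingAut K) : K ≃+* K)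
  have hχ : Function.Injective χ := by
    intro i j hij
    have h1 : (σ ^ (i : ℕ))⁻¹ = (σ ^ (j : ℕ))⁻¹ := RingEquiv.ext fun x => DFunLike.congr_fun hij x
    have h2 := pow_injOn_Iio_orderOf (x := σ) (hσ ▸ i.2 : (i : ℕ) ∈ Set.Iio (orderOf σ))
      (hσ ▸ j.2 : (j : ℕ) ∈ Set.Iio (orderOf σ)) (inv_injective h1)
    exact Fin.ext h2
  have := Fintype.linearIndependent_iff.1 (hli.comp χ hχ) (fun i => g i) (by
    funext t
    rw [Finset.sum_apply]
    simp only [Function.comp_apply, Pi.smul_apply, smul_eq_mul, Pi.zero_apply]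
    rw [← h t, Finset.sum_range]
    exact Finset.sum_congr rfl fun i _ => mul_comm _ _) ⟨i, hi⟩
  exact this

theorem exists_three_of_continuant_eq_zero (hσ : orderOf σ = n) (hn : 1 < n) (ha : a ≠ 0)
    (h0 : continuant σ a n = 0) {b : K}
    (hb : ∏ j ∈ Finset.range n, (σ ^ j) b = continuant σ a (n + 1)) :
    ∃ x y z : K, σ x * x - x = a ∧ σ y * y - y = a ∧ σ z * z - z = a ∧
      x ≠ y ∧ z ≠ x ∧ z ≠ y := by
  have hσ1 : σ ^ n = 1 := hσ ▸ pow_orderOf_eq_one σ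
  have hb0 : b ≠ 0 := by
    rintro rfl
    apply continuant_succ_ne_zero ha h0
    rw [← hb]
    exact Finset.prod_eq_zero (Finset.mem_range.2 (zero_lt_one.trans hn)) (by simp)
  set P : ℕ → K := fun i => ∏ j ∈ Finset.range i, (σ ^ j) b with hP
  have hP0 : ∀ i, P i ≠ 0 := fun i => Finset.prod_ne_zero_iff.2 fun j _ => (_root_.map_ne_zero _).2 hb0
  have hPs : ∀ i, P (i + 1) = P i * (σ ^ i) b := fun i => Finset.prod_range_succ _ _
  have hPn : ∀ i, P (n + i) = continuant σ a (n + 1) * P i := by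
    intro i
    simp only [hP]
    rw [Finset.prod_range_add, hb]
    simp [pow_add, hσ1]
  set s : ℕ → K := fun i => continuant σ a i / P i with hs
  have hsn : ∀ i, s (n + i) = s i := fun i => by
    simp only [hs]
    rw [continuant_add hσ1 h0, hPn, mul_div_mul_left _ _ (continuant_succ_ne_zero ha h0)]
  have hs0 : s 0 = 0 := by simp [hs, continuant]
  have hs1 : s 1 ≠ 0 := div_ne_zero (by simp [continuant]) (hP0 1)
  -- The continuant recurrence divided by `P i`; resolvents turn it into `heq`.
  have hrec : ∀ i, (σ ^ i) (b * σ b) * s (i + 2) = (σ ^ i) b * s (i + 1) + (σ ^ i) a * s i := by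
    intro i
    have e0 := hP0 i
    have e1 : (σ ^ i) b ≠ 0 := (_root_.map_ne_zero _).2 hb0
    have e2 : (σ ^ (i + 1)) b ≠ 0 := (_root_.map_ne_zero _).2 hb0
    simp only [hs]
    rw [hPs (i + 1), hPs i, continuant, map_mul, ← RingAut.pow_succ_apply]
    field_simp
  set z : K → K := cyclicResolvent σ n s with hz
  have hz1 : ∀ t, σ (z t) = cyclicResolvent σ n (fun i => s (i + 1)) t := fun t =>
    map_cyclicResolvent hσ1 (hsn 0) t
  have hz2 : ∀ t, σ (σ (z t)) = cyclicResolvent σ n (fun i => s (i + 2)) t := fun t => by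
    rw [hz1, map_cyclicResolvent hσ1 (by rw [zero_add]; exact hsn 1)]
  have hadd : ∀ t t', z (t + t') = z t + z t' := fun t t' => by
    simp only [hz, cyclicResolvent, add_mul, map_add, Finset.sum_add_distrib]
  have heq : ∀ t, b * σ b * σ (σ (z t)) = b * σ (z t) + a * z t := by
    intro t
    rw [hz2, hz1, hz, mul_cyclicResolvent, mul_cyclicResolvent, mul_cyclicResolvent]
    simp only [hrec]
    simp only [cyclicResolvent, mul_add, map_add, Finset.sum_add_distrib]
  have hroot : ∀ t, z t ≠ 0 →
      σ (b * σ (z t) / z t) * (b * σ (z t) / z t) - b * σ (z t) / z t = a := by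
    intro t ht
    have ht' : σ (z t) ≠ 0 := (_root_.map_ne_zero σ).2 ht
    have := heq t
    rw [map_div₀, map_mul]
    field_simp
    linear_combination this
  have hexp : ∀ (s' : ℕ → K) (t : K), cyclicResolvent σ n s' t =
      ∑ i ∈ Finset.range n, (σ ^ i)⁻¹ t * (σ ^ i)⁻¹ (s' i) := fun s' t => by
    simp only [cyclicResolvent, map_mul]
  -- Independence is read at index 1, since `s 0 = 0`; this needs `1 < n`.
  obtain ⟨t₀, ht₀⟩ : ∃ t, z t ≠ 0 := by
    by_contra! h
    have := eq_zero_of_sum_inv_pow_eq_zero hσ (g := fun i => (σ ^ i)⁻¹ (s i))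
      (fun t => by rw [← hexp]; exact h t) hn
    exact hs1 ((_root_.map_eq_zero _).1 this)
  -- Here index 0 suffices: as `s 0 = 0`, its coefficient is `s 1 * z t₀`. The inequality separates
  -- the zeros built from `t₀`, `t₁` and `t₀ + t₁`.
  obtain ⟨t₁, ht₁⟩ : ∃ t, σ (z t) * z t₀ ≠ z t * σ (z t₀) := by
    by_contra! h
    have := eq_zero_of_sum_inv_pow_eq_zero hσ
      (g := fun i => (σ ^ i)⁻¹ (s (i + 1)) * z t₀ - (σ ^ i)⁻¹ (s i) * σ (z t₀))
      (fun t => by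
        have e := h t
        rw [hz1 t, hexp, hz, hexp s t, ← hz, ← sub_eq_zero, Finset.sum_mul, Finset.sum_mul,
          ← Finset.sum_sub_distrib] at e
        rw [← e]
        exact Finset.sum_congr rfl fun i _ => by ring) (zero_lt_one.trans hn)
    simp only [pow_zero, inv_one, RingAut.one_apply, zero_add, hs0, zero_mul, sub_zero] at this
    exact mul_ne_zero hs1 ht₀ this
  have ht₁' : z t₁ ≠ 0 := by
    intro h
    simp [h] at ht₁
  have ht₂ : z (t₀ + t₁) ≠ 0 := by
    intro h
    have h1 : z t₁ = - z t₀ := by rw [hadd] at h; linear_combination h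
    apply ht₁
    rw [h1, map_neg]
    ring
  refine ⟨_, _, _, hroot t₀ ht₀, hroot t₁ ht₁', hroot (t₀ + t₁) ht₂, ?_, ?_, ?_⟩
  · intro h
    field_simp at h
    apply ht₁
    linear_combination -h
  · intro h
    field_simp at h
    rw [hadd, map_add] at h
    apply ht₁
    linear_combination h
  · intro h
    field_simp at h
    rw [hadd, map_add] at h
    apply ht₁
    linear_combination -h

end Continuants

/-! ### Fixed fields, norms and the order of Frobenius. -/

section FiniteField

theorem prod_range_mul_mod {M : Type*} [CommMonoid M] {n m : ℕ} (h : m.Coprime n) (f : ℕ → M) :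
    ∏ j ∈ Finset.range n, f (m * j % n) = ∏ j ∈ Finset.range n, f j := by
  have hinj : Set.InjOn (fun j => m * j % n) (Finset.range n) := by
    intro i hi j hj hij
    have h1 : i ≡ j [MOD n] := Nat.ModEq.cancel_left_of_coprime (Nat.coprime_comm.1 h) hij
    rwa [Nat.ModEq, Nat.mod_eq_of_lt (by simpa using hi), Nat.mod_eq_of_lt (by simpa using hj)]
      at h1
  have himg : (Finset.range n).image (fun j => m * j % n) = Finset.range n := by
    apply Finset.eq_of_subset_of_card_le
    · intro x hx
      obtain ⟨j, hj, rfl⟩ := Finset.mem_image.1 hx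
      exact Finset.mem_range.2 (Nat.mod_lt _ (Nat.zero_lt_of_lt (Finset.mem_range.1 hj)))
    · rw [Finset.card_image_of_injOn hinj]
  conv_rhs => rw [← himg, Finset.prod_image hinj]

variable {K : Type*} [Field K] [Finite K] {k : ℕ}

/-- The nonzero solutions are the kernel of a power map on the cyclic group `Kˣ`, of order `gcd(2^m
- 1, 2^k - 1)`. -/
theorem ncard_pow_two_pow_eq_self (hK : Nat.card K = 2 ^ k) (m : ℕ) :
    {u : K | u ^ 2 ^ m = u}.ncard = 2 ^ Nat.gcd m k := by
  have h : {u : K | u ^ 2 ^ m = u} =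
      insert 0 ((fun u : Kˣ => (u : K)) '' (powMonoidHom (α := Kˣ) (2 ^ m - 1)).ker) := by
    have hm : 2 ^ m = (2 ^ m - 1) + 1 := (Nat.sub_add_cancel Nat.one_le_two_pow).symm
    ext u
    simp only [Set.mem_ofPred_eq, Set.mem_insert_iff, Set.mem_image, SetLike.mem_coe,
      MonoidHom.mem_ker, powMonoidHom_apply]
    constructor
    · intro hu
      refine or_iff_not_imp_left.2 fun h0 => ⟨Units.mk0 u h0, ?_, rfl⟩
      rw [hm, pow_succ] at hu
      ext
      simpa using mul_right_cancel₀ h0 (hu.trans (one_mul u).symm)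
    · rintro (rfl | ⟨v, hv, rfl⟩)
      · exact zero_pow (by positivity)
      · rw [hm, pow_succ, ← Units.val_pow_eq_pow_val, hv, Units.val_one, one_mul]
  rw [h, Set.ncard_insert_of_notMem (by simp), Set.ncard_image_of_injective _ Units.val_injective,
    ← Nat.card_coe_set_eq]
  simp only [SetLike.coe_sort_coe]
  rw [IsCyclic.card_powMonoidHom_ker, Nat.card_units, hK, Nat.pow_sub_one_gcd_pow_sub_one,
    Nat.gcd_comm, Nat.sub_add_cancel Nat.one_le_two_pow]

/-- Surjectivity of the norm to `GF(2^d)`: if `c = g^j` for a generator `g`, then `c^(2^d - 1) = 1`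
makes the norm exponent divide `j`. -/
theorem exists_prod_pow_two_pow_eq {n d : ℕ} (hK : Nat.card K = 2 ^ (n * d)) (hd : 0 < d)
    {c : K} (hc0 : c ≠ 0) (hc : c ^ 2 ^ d = c) :
    ∃ b : K, ∏ j ∈ Finset.range n, b ^ 2 ^ (d * j) = c := by
  obtain ⟨g, hg⟩ := IsCyclic.exists_monoid_generator (α := Kˣ)
  obtain ⟨j, hj⟩ := hg (Units.mk0 c hc0)
  have ho : orderOf g = 2 ^ (n * d) - 1 := by
    rw [orderOf_eq_card_of_forall_mem_powers hg, Nat.card_units, hK]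
  have hgeom : (∑ i ∈ Finset.range n, 2 ^ (d * i)) * (2 ^ d - 1) = 2 ^ (n * d) - 1 := by
    rw [Finset.sum_congr rfl fun i _ => pow_mul 2 d i, Nat.geomSum_eq (Nat.one_lt_two_pow hd.ne') n, mul_comm n d, pow_mul 2 d n]
    exact Nat.div_mul_cancel (by simpa using Nat.sub_dvd_pow_sub_pow (2 ^ d) 1 n)
  have hd1 : 0 < 2 ^ d - 1 := Nat.sub_pos_of_lt (Nat.one_lt_two_pow hd.ne')
  have hdvd : (∑ i ∈ Finset.range n, 2 ^ (d * i)) ∣ j := by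
    have h1 : g ^ (j * (2 ^ d - 1)) = 1 := by
      have hm : 2 ^ d = (2 ^ d - 1) + 1 := (Nat.sub_add_cancel Nat.one_le_two_pow).symm
      rw [hm, pow_succ] at hc
      simp only at hj
      rw [pow_mul, hj]
      ext
      simpa using mul_right_cancel₀ hc0 (hc.trans (one_mul c).symm)
    have h2 := orderOf_dvd_of_pow_eq_one h1
    rw [ho, ← hgeom] at h2
    exact Nat.dvd_of_mul_dvd_mul_right hd1 h2
  obtain ⟨i, rfl⟩ := hdvd
  refine ⟨((g ^ i : Kˣ) : K), ?_⟩
  rw [Finset.prod_pow_eq_pow_sum, ← Units.val_pow_eq_pow_val, ← pow_mul, mul_comm i]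
  simp only at hj
  rw [hj, Units.val_mk0]

variable [CharP K 2] (l : ℕ)

theorem iterateFrobeniusEquiv_pow_apply (i : ℕ) (x : K) :
    ((iterateFrobeniusEquiv K 2 l : RingAut K) ^ i) x = x ^ 2 ^ (l * i) := by
  induction i with
  | zero => simp
  | succ i ih =>
    rw [RingAut.pow_succ_apply', ih, iterateFrobeniusEquiv_def, ← pow_mul, ← pow_add, mul_add_one]

variable {l} {d n : ℕ}

theorem coprime_div_of_gcd (hl : 0 < l) (hd : Nat.gcd l k = d) (hn : k = n * d) :
    ∃ m, l = m * d ∧ m.Coprime n ∧ 0 < d := by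
  have hd0 : 0 < d := hd ▸ Nat.gcd_pos_of_pos_left _ hl
  obtain ⟨m, rfl⟩ : d ∣ l := hd ▸ Nat.gcd_dvd_left l k
  refine ⟨m, mul_comm _ _, ?_, hd0⟩
  rw [hn, mul_comm d m, Nat.gcd_mul_right] at hd
  exact Nat.eq_of_mul_eq_mul_right hd0 (by rw [hd, one_mul])

theorem orderOf_iterateFrobeniusEquiv (hK : Nat.card K = 2 ^ k) (hl : 0 < l)
    (hd : Nat.gcd l k = d) (hn : k = n * d) :
    orderOf (iterateFrobeniusEquiv K 2 l : RingAut K) = n := by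
  obtain ⟨m, hm, hmn, hd0⟩ := coprime_div_of_gcd hl hd hn
  have key : ∀ i, (iterateFrobeniusEquiv K 2 l : RingAut K) ^ i = 1 ↔ n ∣ i := by
    intro i
    have h1 : (iterateFrobeniusEquiv K 2 l : RingAut K) ^ i = 1 ↔
        {u : K | u ^ 2 ^ (l * i) = u} = Set.univ := by
      rw [Set.eq_univ_iff_forall]
      constructor
      · intro h x
        rw [Set.mem_ofPred_eq, ← iterateFrobeniusEquiv_pow_apply, h, RingAut.one_apply]
      · intro h
        ext x
        rw [iterateFrobeniusEquiv_pow_apply]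
        exact h x
    rw [h1, Set.eq_univ_iff_ncard, ncard_pow_two_pow_eq_self hK, hK,
      Nat.pow_right_inj one_lt_two, Nat.gcd_eq_right_iff_dvd, hn, hm, mul_right_comm,
      Nat.mul_dvd_mul_iff_right hd0]
    exact (Nat.coprime_comm.1 hmn).dvd_mul_left
  exact Nat.dvd_antisymm (orderOf_dvd_of_pow_eq_one ((key n).2 dvd_rfl))
    ((key _).1 (pow_orderOf_eq_one _))

theorem exists_prod_iterateFrobeniusEquiv_eq (hK : Nat.card K = 2 ^ k) (hl : 0 < l)
    (hd : Nat.gcd l k = d) (hn : k = n * d) {c : K} (hc0 : c ≠ 0)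
    (hc : iterateFrobeniusEquiv K 2 l c = c) :
    ∃ b : K, ∏ j ∈ Finset.range n, ((iterateFrobeniusEquiv K 2 l : RingAut K) ^ j) b = c := by
  obtain ⟨m, hm, hmn, hd0⟩ := coprime_div_of_gcd hl hd hn
  have hcd : c ^ 2 ^ d = c := by
    have hsub : {u : K | u ^ 2 ^ d = u} ⊆ {u : K | u ^ 2 ^ l = u} := by
      intro u hu
      have : ∀ i, u ^ 2 ^ (i * d) = u := by
        intro i
        induction i with
        | zero => simp
        | succ i ih => rw [add_one_mul, pow_add, pow_mul, ih, hu]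
      rw [Set.mem_ofPred_eq, hm]
      exact this m
    have heq := Set.eq_of_subset_of_ncard_le hsub (by
      rw [ncard_pow_two_pow_eq_self hK, ncard_pow_two_pow_eq_self hK, hd]
      rw [hn, Nat.gcd_mul_left_right])
    exact heq.symm.subset hc
  rw [hn] at hK
  obtain ⟨b, hb⟩ := exists_prod_pow_two_pow_eq hK hd0 hc0 hcd
  refine ⟨b, ?_⟩
  -- `σ` is the `m`-th power of the `2^d`-Frobenius with `m` prime to `n`, so both norms have the
  -- same factors, permuted.
  rw [← hb, ← prod_range_mul_mod hmn fun j => b ^ 2 ^ (d * j)]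
  refine Finset.prod_congr rfl fun j _ => ?_
  have h1 : (iterateFrobeniusEquiv K 2 d : RingAut K) ^ n = 1 := by
    ext x
    rw [iterateFrobeniusEquiv_pow_apply, mul_comm, ← hK, RingAut.one_apply]
    have := Fintype.ofFinite K
    rw [Nat.card_eq_fintype_card, FiniteField.pow_card]
  rw [← iterateFrobeniusEquiv_pow_apply d (m * j % n), ← pow_eq_pow_mod _ h1, iterateFrobeniusEquiv_pow_apply,
    iterateFrobeniusEquiv_pow_apply, hm]
  congr 2
  ring

end FiniteField

/-! ### Translation to `P_a`, `C_n` and `M`. -/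

section Main

variable {K : Type*} [Field K] [Finite K] [CharP K 2]

theorem eval_polyC_eq_continuant (l : ℕ) (a : K) (i : ℕ) :
    (polyC K l i).eval a = continuant (iterateFrobeniusEquiv K 2 l) a i := by
  induction i using polyC.induct with
  | case1 => simp [polyC, continuant]
  | case2 => simp [polyC, continuant]
  | case3 => simp [polyC, continuant]
  | case4 i ih1 ih2 =>
    rw [polyC, eval_add, eval_mul, ih1, ih2, eval_pow, eval_X, continuant_add_two _ _ (i + 1),
      iterateFrobeniusEquiv_pow_apply, mul_comm l]

theorem numZerosP_eq_ncard_fiber (l : ℕ) (a : K) :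
    numZerosP l a = {v : K | iterateFrobeniusEquiv K 2 l v * v - v = a}.ncard := by
  unfold numZerosP polyP
  congr 1
  ext v
  simp only [Set.mem_ofPred_eq, IsRoot.def, eval_add, eval_pow, eval_X, eval_C,
    iterateFrobeniusEquiv_def]
  rw [pow_succ, CharTwo.sub_eq_add, CharTwo.add_eq_zero]

variable {k l d n : ℕ}

theorem ncard_fixed_iterateFrobeniusEquiv (hK : Nat.card K = 2 ^ k) (hd : Nat.gcd l k = d) :
    {u : K | iterateFrobeniusEquiv K 2 l u = u}.ncard = 2 ^ d := by
  simp only [iterateFrobeniusEquiv_def]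
  rw [ncard_pow_two_pow_eq_self hK, hd]

theorem numZerosP_eq_iff (hK : Nat.card K = 2 ^ k) (hl : 0 < l) (hlk : l < k)
    (hd : Nat.gcd l k = d) (hn : k = n * d) {a : K} (ha : a ≠ 0) :
    numZerosP l a = 2 ^ d + 1 ↔ (polyC K l n).eval a = 0 := by
  obtain ⟨m, hm, hmn, hd0⟩ := coprime_div_of_gcd hl hd hn
  have hn1 : 1 < n := by
    by_contra! h
    have h1 : k ≤ d := hn ▸ mul_le_of_le_one_left (Nat.zero_le d) h
    have h2 : d ≤ l := hd ▸ Nat.gcd_le_left k hl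
    omega
  have ho := orderOf_iterateFrobeniusEquiv hK hl hd hn
  rw [eval_polyC_eq_continuant, numZerosP_eq_ncard_fiber]
  constructor
  · intro h
    have h2 : 1 < 2 ^ d := Nat.one_lt_two_pow hd0.ne'
    obtain ⟨x, y, z, hx, hy, hz, hxy, hxz, hyz⟩ := (Set.two_lt_ncard_iff).1
      (show 2 < {v : K | iterateFrobeniusEquiv K 2 l v * v - v = a}.ncard by omega)
    exact continuant_eq_zero_of_map_eq (orderOf_dvd_iff_pow_eq_one.1 ho.dvd)
      (zero_lt_one.trans hn1).ne' ha hx hy hxy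
      (div_ne_zero (sub_ne_zero.2 hxz.symm) (sub_ne_zero.2 hyz.symm))
      (map_cross_ratio ha hx hy hz hyz.symm)
  · intro h0
    obtain ⟨b, hb⟩ := exists_prod_iterateFrobeniusEquiv_eq hK hl hd hn
      (continuant_succ_ne_zero ha h0) (map_continuant_succ h0)
    obtain ⟨x, y, z, hx, hy, hz, hxy, hzx, hzy⟩ :=
      exists_three_of_continuant_eq_zero ho hn1 ha h0 hb
    rw [ncard_fiber_of_three ha hx hy hz hxy hzx hzy, ncard_fixed_iterateFrobeniusEquiv hK hd]

theorem countM_mul_add_eq (hK : Nat.card K = 2 ^ k) (hd : Nat.gcd l k = d) :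
    (countM K l (2 ^ d + 1) : ℚ) * ((2 ^ d + 1) * 2 ^ d * (2 ^ d - 1)) + 2 ^ Nat.gcd (2 * l) k =
      2 ^ k := by
  have h := ncard_full_fibers_mul_descFactorial (iterateFrobeniusEquiv K 2 l) (2 ^ d + 1)
    (by rw [ncard_fixed_iterateFrobeniusEquiv hK hd])
  have hc := Set.ncard_add_ncard_compl {w : K | w ^ 2 ^ (2 * l) = w}
  have hset : {w : K | w ^ 2 ^ (2 * l) = w}ᶜ =
      {w : K | iterateFrobeniusEquiv K 2 l (iterateFrobeniusEquiv K 2 l w) ≠ w} := by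
    ext w
    simp only [Set.mem_compl_iff, Set.mem_ofPred_eq, iterateFrobeniusEquiv_def, two_mul, pow_add,
      pow_mul, ne_eq]
  rw [ncard_pow_two_pow_eq_self hK, hset, ← h, hK] at hc
  have hM : countM K l (2 ^ d + 1) = {a : K | a ≠ 0 ∧
      {v : K | iterateFrobeniusEquiv K 2 l v * v - v = a}.ncard = 2 ^ d + 1}.ncard := by
    simp only [countM, numZerosP_eq_ncard_fiber]
  rw [← hM] at hc
  have hq : (1 : ℕ) ≤ 2 ^ d := Nat.one_le_two_pow
  have hdesc : ((2 ^ d + 1).descFactorial 3 : ℚ) = (2 ^ d + 1) * 2 ^ d * (2 ^ d - 1) := by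
    have : (2 ^ d + 1).descFactorial 3 = (2 ^ d + 1) * 2 ^ d * (2 ^ d - 1) := by
      simp [Nat.descFactorial]
      ring
    rw [this]
    push_cast [Nat.cast_sub hq]
    ring
  rw [← hdesc]
  have := congrArg (Nat.cast (R := ℚ)) hc
  push_cast at this
  linarith

end Main

theorem mainTheorem5 {K : Type*} [Field K] [Finite K] (k l d n : ℕ)
    (hK : Nat.card K = 2 ^ k) (hl : 0 < l) (hlk : l < k)
    (hd : Nat.gcd l k = d) (hn : k = n * d) :
    (∀ a : K, a ≠ 0 → (numZerosP l a = 2 ^ d + 1 ↔ (polyC K l n).eval a = 0)) ∧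
    (Odd n → (countM K l (2 ^ d + 1) : ℚ) =
      ((2 : ℚ) ^ (k - d) - 1) / ((2 : ℚ) ^ (2 * d) - 1)) ∧
    (Even n → (countM K l (2 ^ d + 1) : ℚ) =
      ((2 : ℚ) ^ (k - d) - (2 : ℚ) ^ d) / ((2 : ℚ) ^ (2 * d) - 1)) := by
  have : CharP K 2 := by
    have := Fintype.ofFinite K
    exact charP_of_card_eq_prime_pow (f := k) (by rw [← Nat.card_eq_fintype_card, hK])
  obtain ⟨m, hm, hmn, hd0⟩ := coprime_div_of_gcd hl hd hn
  have hcount := countM_mul_add_eq hK hd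
  have hdk : d ≤ k := hd ▸ Nat.gcd_le_right l (hl.trans hlk)
  have hk : (2 : ℚ) ^ k = 2 ^ (k - d) * 2 ^ d := by rw [← pow_add, Nat.sub_add_cancel hdk]
  have hq1 : (1 : ℚ) < 2 ^ d := one_lt_pow₀ (by norm_num) hd0.ne'
  have hq2 : (2 : ℚ) ^ (2 * d) - 1 ≠ 0 := by
    have : (1 : ℚ) < 2 ^ (2 * d) := one_lt_pow₀ (by norm_num) (by omega)
    linarith
  have hq0 : (2 : ℚ) ^ d ≠ 0 := by positivity
  -- Parity of `n` enters only here: the fixed field of `σ ^ 2` has `2^d` elements for odd `n` and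
  -- `2^(2d)` for even `n`.
  have hgcd : Nat.gcd (2 * l) k = Nat.gcd 2 n * d := by
    rw [hm, hn, ← mul_assoc, Nat.gcd_mul_right, Nat.Coprime.gcd_mul_right_cancel 2 hmn]
  rw [hgcd, hk] at hcount
  refine ⟨fun a ha => numZerosP_eq_iff hK hl hlk hd hn ha, fun ho => ?_, fun he => ?_⟩
  · rw [Nat.coprime_two_left.2 ho, one_mul] at hcount
    rw [eq_div_iff hq2, mul_comm 2 d, pow_mul]
    apply mul_right_cancel₀ hq0
    linear_combination hcount
  · rw [Nat.gcd_eq_left he.two_dvd, mul_comm 2 d, pow_mul] at hcount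
    rw [eq_div_iff hq2, mul_comm 2 d, pow_mul]
    apply mul_right_cancel₀ hq0
    linear_combination hcount
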